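/- Let $m \ge 1$ and $d_0 \ge 1$ be integers, and let $H_1, \dots, H_m$ be complex Hilbert spaces, each of dimension $d_0$. Let $\rho$ be an $m$-partite unnormalized density matrix with local dimension $d_0$, that is, a positive semidefinite (Hermitian) complex matrix on $H_1 \otimes \cdots \otimes H_m$, with entries $\rho(i_1,\dots,i_m; j_1,\dots,j_m)$, $1 \le i_k, j_k \le d_0$, in a product of orthonormal bases. Let $I$ be the identity matrix and let $\|A\|_2 = \sqrt{\operatorname{tr} A^\dagger A}$ be the Frobenius norm. If $$\|\rho - I\|_2 \le \left(\frac{d_0}{2d_0-1}\right)^{m/2-1},$$ then $\rho$ is separable: it is a finite sum, with nonnegative real coefficients, of matrices of the form $A_1 \otimes A_2 \otimes \cdots \otimes A_m$ in which every $A_k$ is a positive semidefinite $d_0 \times d_0$ matrix. -/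

import Mathlib

open scoped Matrix.Norms.Frobenius ComplexOrder

namespace Multipartite

/-- Complex matrices on the tensor product of systems of dimensions `d 0, …, d (m - 1)`, with
entries `ρ (i₁, …, i_m) (j₁, …, j_m)` in a product basis. -/
abbrev MultiMatrix {m : ℕ} (d : Fin m → ℕ) : Type :=
  Matrix ((k : Fin m) → Fin (d k)) ((k : Fin m) → Fin (d k)) ℂ

/-- The tensor (Kronecker) product `A₁ ⊗ ⋯ ⊗ A_m` of local matrices. -/
def tensor {m : ℕ} {d : Fin m → ℕ} (A : (k : Fin m) → Matrix (Fin (d k)) (Fin (d k)) ℂ) :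
    MultiMatrix d :=
  Matrix.of fun i j => ∏ k, A k (i k) (j k)

/-- The `(C₁ ⊗ ⋯ ⊗ C_m)`-separable cone: all finite nonnegative combinations of product matrices
`A₁ ⊗ ⋯ ⊗ A_m` with `A_k ∈ C_k`. -/
noncomputable def separableCone {m : ℕ} {d : Fin m → ℕ}
    (C : (k : Fin m) → Set (Matrix (Fin (d k)) (Fin (d k)) ℂ)) :
    PointedCone ℝ (MultiMatrix d) :=
  PointedCone.hull ℝ {X | ∃ A : (k : Fin m) → Matrix (Fin (d k)) (Fin (d k)) ℂ,
    (∀ k, A k ∈ C k) ∧ X = tensor A}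

/-- The cone of positive semidefinite (Hermitian) matrices. -/
def psdCone (n : ℕ) : Set (Matrix (Fin n) (Fin n) ℂ) :=
  {A | A.PosSemidef}

/-- A matrix is separable if it lies in the separable cone of the local positive semidefinite
cones. -/
def IsSeparable {m : ℕ} (d : Fin m → ℕ) (ρ : MultiMatrix d) : Prop :=
  ρ ∈ separableCone fun k => psdCone (d k)

end Multipartite

/-! ### Spectral resolution of unitary matrices. -/

namespace Multipartite

open Matrix

/-! By Hahn–Banach, a positive semidefinite `ρ` is separable once `tr (ρ W) ≥ 0` for every
entanglement witness `W` (`isSeparable_of_forall_isWitness`). Since `tr (ρ W) ≥ tr W - ‖ρ - 1‖ ‖W‖`,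
it suffices to have `‖W‖ ≤ (2 - 1/d)^((m-2)/2) tr W`, which is `IsWitness.frobenius_norm_le`.

That bound goes by induction on the number of parties, splitting `W` into blocks along the first
system. For two parties, the blocks define a positive map, whose 2×2 minors, combined with the polar
decomposition of a block, give `‖W i j‖² ≤ tr (W i i) tr (W j j)` (`frobenius_norm_sq_le_of_trace`).
For more parties, compressing `W` along a local vector yields a witness with one party fewer. In a
basis diagonalising the matrix of block traces, off-diagonal blocks are traceless, and averaging
over phases bounds them by `‖W i j‖² ≤ 2 p i p j`, while `‖W i i‖ ≤ p i`. Summation and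
Cauchy–Schwarz cost a factor `2 - 1/d` in the squared norm (`sum_frobenius_norm_sq_le`). -/

theorem exists_resolution_of_finite_spectrum {A : Type*} [CStarAlgebra A] {u : A}
    (hu : u ∈ unitary A) (hfin : (spectrum ℂ u).Finite) :
    ∃ (s : Finset ℂ) (P : ℂ → A), (∀ z, star (P z) * P z = P z) ∧ (∀ z ∈ s, ‖z‖ = 1) ∧
      ∑ z ∈ s, P z = 1 ∧ ∑ z ∈ s, z • P z = u := by
  classical
  have hn : IsStarNormal u := by
    constructor
    rw [commute_iff_eq, Unitary.star_mul_self_of_mem hu, Unitary.mul_star_self_of_mem hu]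
  -- On a finite spectrum even point indicators are continuous, so the functional calculus produces
  -- the spectral projections.
  have hc : ∀ f : ℂ → ℂ, ContinuousOn f (spectrum ℂ u) := fun f => hfin.continuousOn f
  let g : ℂ → ℂ → ℂ := fun z w => if w = z then 1 else 0
  refine ⟨hfin.toFinset, fun z => cfc (g z) u, ?_, ?_, ?_, ?_⟩
  · intro z
    rw [← cfc_star, ← cfc_mul _ _ u (hc _) (hc _)]
    congr 1
    ext w
    by_cases h : w = z <;> simp [g, h]
  · intro z hz
    have := spectrum.subset_circle_of_unitary hu (hfin.mem_toFinset.1 hz)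
    simpa using this
  · rw [← cfc_sum _ _ _ (fun i _ => hc _), ← cfc_one ℂ u]
    refine cfc_congr fun w hw => ?_
    simp [g, Finset.sum_ite_eq, hw]
  · simp_rw [← cfc_smul _ _ _ (hc _)]
    rw [← cfc_sum _ _ _ (fun i _ => hc _)]
    conv_rhs => rw [← cfc_id ℂ u]
    refine cfc_congr fun w hw => ?_
    simp [g, Finset.sum_ite_eq, hw]

theorem exists_resolution_of_mem_unitaryGroup {κ : Type*} [Fintype κ] [DecidableEq κ]
    {U : Matrix κ κ ℂ} (hU : U ∈ unitaryGroup κ ℂ) :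
    ∃ (s : Finset ℂ) (P : ℂ → Matrix κ κ ℂ), (∀ z, (P z).PosSemidef) ∧ (∀ z ∈ s, ‖z‖ = 1) ∧
      ∑ z ∈ s, P z = 1 ∧ ∑ z ∈ s, z • P z = U := by
  -- The C⋆-structure is supplied explicitly because the ambient Frobenius norm is not a C⋆-norm.
  obtain ⟨s, P, h1, h2, h3, h4⟩ := @exists_resolution_of_finite_spectrum (Matrix κ κ ℂ)
    Matrix.instCStarAlgebra U hU (Matrix.finite_spectrum U)
  exact ⟨s, P, fun z => h1 z ▸ posSemidef_conjTranspose_mul_self (P z), h2, h3, h4⟩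

/-! ### Frobenius norm estimates and the positive-map inequality. -/

section Trace

variable {κ n : Type*} [Fintype κ] [Fintype n]

theorem frobenius_norm_sq (M : Matrix n κ ℂ) : ‖M‖ ^ 2 = ∑ i, ∑ j, ‖M i j‖ ^ 2 := by
  have h : 0 ≤ ∑ i, ∑ j, ‖M i j‖ ^ 2 := by positivity
  rw [frobenius_norm_def]
  simp only [Real.rpow_two]
  rw [← Real.sqrt_eq_rpow, Real.sq_sqrt h]

theorem frobenius_norm_sq_eq_re_trace (M : Matrix n κ ℂ) : ‖M‖ ^ 2 = (Mᴴ * M).trace.re := by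
  rw [frobenius_norm_sq, Finset.sum_comm]
  simp only [trace, diag, mul_apply, conjTranspose_apply, Complex.re_sum]
  refine Finset.sum_congr rfl fun i _ => Finset.sum_congr rfl fun j _ => ?_
  rw [← Complex.normSq_eq_norm_sq, Complex.star_def, ← Complex.normSq_eq_conj_mul_self,
    Complex.ofReal_re]

theorem frobenius_parallelogram (X Y : Matrix n κ ℂ) :
    ‖X + Y‖ ^ 2 + ‖X - Y‖ ^ 2 = 2 * ‖X‖ ^ 2 + 2 * ‖Y‖ ^ 2 := by
  simp only [frobenius_norm_sq, Finset.mul_sum, ← Finset.sum_add_distrib]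
  refine Finset.sum_congr rfl fun i _ => Finset.sum_congr rfl fun j _ => ?_
  have := parallelogram_law_with_norm ℝ (X i j) (Y i j)
  simp only [Matrix.add_apply, Matrix.sub_apply]
  nlinarith

theorem abs_re_trace_mul_le (X Y : Matrix n n ℂ) : |(X * Y).trace.re| ≤ ‖X‖ * ‖Y‖ := by
  have h1 : ‖(X * Y).trace‖ ≤ ∑ p : n × n, ‖X p.1 p.2‖ * ‖Y p.2 p.1‖ := by
    simp only [trace, diag, mul_apply, Fintype.sum_prod_type]
    refine (norm_sum_le _ _).trans (Finset.sum_le_sum fun i _ => ?_)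
    exact (norm_sum_le _ _).trans (Finset.sum_le_sum fun j _ => (norm_mul _ _).le)
  have h2 : ∑ p : n × n, ‖X p.1 p.2‖ ^ 2 = ‖X‖ ^ 2 := by
    rw [frobenius_norm_sq, Fintype.sum_prod_type]
  have h3 : ∑ p : n × n, ‖Y p.2 p.1‖ ^ 2 = ‖Y‖ ^ 2 := by
    rw [frobenius_norm_sq, Fintype.sum_prod_type, Finset.sum_comm]
  refine (Complex.abs_re_le_norm _).trans (h1.trans ?_)
  refine (Real.sum_mul_le_sqrt_mul_sqrt _ _ _).trans ?_
  rw [h2, h3, Real.sqrt_sq (norm_nonneg _), Real.sqrt_sq (norm_nonneg _)]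

theorem PosSemidef.exists_eq_conjTranspose_mul_self {S : Matrix κ κ ℂ} (hS : S.PosSemidef) :
    ∃ R : Matrix κ κ ℂ, S = Rᴴ * R := by
  classical
  open scoped MatrixOrder in
  exact CStarAlgebra.nonneg_iff_eq_star_mul_self.mp (nonneg_iff_posSemidef.2 hS)

theorem PosSemidef.frobenius_norm_le_re_trace {S : Matrix κ κ ℂ} (hS : S.PosSemidef) :
    ‖S‖ ≤ S.trace.re := by
  obtain ⟨R, rfl⟩ := PosSemidef.exists_eq_conjTranspose_mul_self hS
  rw [← frobenius_norm_sq_eq_re_trace, sq]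
  simpa using frobenius_norm_mul Rᴴ R

theorem PosSemidef.norm_apply_sq_le {S : Matrix κ κ ℂ} (hS : S.PosSemidef) (i j : κ) :
    ‖S i j‖ ^ 2 ≤ (S i i).re * (S j j).re := by
  obtain ⟨R, rfl⟩ := PosSemidef.exists_eq_conjTranspose_mul_self hS
  have hd : ∀ i, ((Rᴴ * R) i i).re = ∑ k, ‖R k i‖ ^ 2 := fun i => by
    simp only [mul_apply, conjTranspose_apply, Complex.re_sum]
    refine Finset.sum_congr rfl fun k _ => ?_
    rw [← Complex.normSq_eq_norm_sq, Complex.star_def, ← Complex.normSq_eq_conj_mul_self,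
      Complex.ofReal_re]
  have h1 : ‖(Rᴴ * R) i j‖ ≤ ∑ k, ‖R k i‖ * ‖R k j‖ := by
    simp only [mul_apply, conjTranspose_apply]
    refine (norm_sum_le _ _).trans (Finset.sum_le_sum fun k _ => ?_)
    simp
  rw [hd, hd]
  exact (pow_le_pow_left₀ (norm_nonneg _) h1 2).trans (Finset.sum_mul_sq_le_sq_mul_sq _ _ _)

/-- An invertible matrix has a unitary `U` with `Uᴴ B` positive semidefinite. -/
theorem exists_unitary_mul_posSemidef [DecidableEq κ] {B : Matrix κ κ ℂ} (hB : IsUnit B) :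
    ∃ U ∈ unitaryGroup κ ℂ, ∃ S : Matrix κ κ ℂ, S.PosSemidef ∧ B = U * S := by
  open scoped MatrixOrder in
  have hG : (Bᴴ * B).PosSemidef := posSemidef_conjTranspose_mul_self B
  let S := CFC.sqrt (Bᴴ * B)
  have hS : S.PosSemidef := nonneg_iff_posSemidef.1 (CFC.sqrt_nonneg _)
  have hSS : S * S = Bᴴ * B := CFC.sqrt_mul_sqrt_self _ (nonneg_iff_posSemidef.2 hG)
  have hdet : IsUnit S.det := by
    have h1 : IsUnit (S * S).det := by
      rw [hSS, det_mul, det_conjTranspose]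
      have := (isUnit_iff_isUnit_det B).1 hB
      exact this.star.mul this
    rw [det_mul] at h1
    exact isUnit_of_mul_isUnit_left h1
  have hSH : (S⁻¹)ᴴ = S⁻¹ := by rw [conjTranspose_nonsing_inv, hS.1.eq]
  refine ⟨B * S⁻¹, ?_, S, hS, by rw [Matrix.mul_assoc, nonsing_inv_mul _ hdet, Matrix.mul_one]⟩
  rw [mem_unitaryGroup_iff', star_eq_conjTranspose, conjTranspose_mul, hSH, Matrix.mul_assoc,
    ← Matrix.mul_assoc Bᴴ, ← hSS, Matrix.mul_assoc S, mul_nonsing_inv _ hdet, Matrix.mul_one,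
    nonsing_inv_mul _ hdet]

/-- Write `B = U S` with `S` positive and resolve `Uᴴ = ∑ z P z` with unimodular `z`. Then `‖B‖ =
‖S‖ ≤ tr S = ∑ z tr (P z B)`; the hypothesis bounds each term, and Cauchy–Schwarz recombines them
because `∑ P z = 1`. -/
theorem frobenius_norm_sq_le_of_isUnit [DecidableEq κ] {A B C : Matrix κ κ ℂ} (hB : IsUnit B)
    (hA : ∀ X : Matrix κ κ ℂ, X.PosSemidef → 0 ≤ (X * A).trace.re)
    (hC : ∀ X : Matrix κ κ ℂ, X.PosSemidef → 0 ≤ (X * C).trace.re)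
    (h : ∀ X : Matrix κ κ ℂ, X.PosSemidef →
      ‖(X * B).trace‖ ^ 2 ≤ (X * A).trace.re * (X * C).trace.re) :
    ‖B‖ ^ 2 ≤ A.trace.re * C.trace.re := by
  obtain ⟨U, hU, S, hS, rfl⟩ := exists_unitary_mul_posSemidef hB
  obtain ⟨s, P, hP, hs, h1, hUP⟩ := exists_resolution_of_mem_unitaryGroup
    (Unitary.star_mem hU)
  have hUU : Uᴴ * U = 1 := Unitary.star_mul_self_of_mem hU
  have hnorm : ‖U * S‖ ^ 2 = ‖S‖ ^ 2 := by
    rw [frobenius_norm_sq_eq_re_trace, frobenius_norm_sq_eq_re_trace, conjTranspose_mul,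
      Matrix.mul_assoc, ← Matrix.mul_assoc Uᴴ, hUU, Matrix.one_mul]
  have htr : S.trace.re ≤ ∑ z ∈ s, √((P z * A).trace.re) * √((P z * C).trace.re) := by
    have e : S = ∑ z ∈ s, z • (P z * (U * S)) := by
      simp_rw [← Matrix.smul_mul]
      rw [← Finset.sum_mul, hUP, star_eq_conjTranspose, ← Matrix.mul_assoc, hUU, Matrix.one_mul]
    rw [e, trace_sum]
    refine (Complex.re_le_norm _).trans ((norm_sum_le _ _).trans (Finset.sum_le_sum fun z hz => ?_))
    rw [trace_smul, norm_smul, hs z hz, one_mul, ← Real.sqrt_mul (hA _ (hP z))]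
    refine Real.le_sqrt_of_sq_le (le_of_eq_of_le ?_ (h _ (hP z)))
    rfl
  have hsum : ∀ A : Matrix κ κ ℂ, ∑ z ∈ s, (P z * A).trace.re = A.trace.re := fun A => by
    rw [← Complex.re_sum, ← trace_sum, ← Finset.sum_mul, h1, Matrix.one_mul]
  rw [hnorm]
  refine (pow_le_pow_left₀ (norm_nonneg _)
    ((PosSemidef.frobenius_norm_le_re_trace hS).trans htr) 2).trans ?_
  refine (Finset.sum_mul_sq_le_sq_mul_sq _ _ _).trans (le_of_eq ?_)
  rw [← hsum A, ← hsum C]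
  congr 1
  · exact Finset.sum_congr rfl fun z _ => Real.sq_sqrt (hA _ (hP z))
  · exact Finset.sum_congr rfl fun z _ => Real.sq_sqrt (hC _ (hP z))

/-- Invertibility is removed by adding `ε • 1` to all three matrices, which preserves the
hypotheses, and letting `ε → 0⁺`. -/
theorem frobenius_norm_sq_le_of_trace [DecidableEq κ] {A B C : Matrix κ κ ℂ}
    (hA : ∀ X : Matrix κ κ ℂ, X.PosSemidef → 0 ≤ (X * A).trace.re)
    (hC : ∀ X : Matrix κ κ ℂ, X.PosSemidef → 0 ≤ (X * C).trace.re)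
    (h : ∀ X : Matrix κ κ ℂ, X.PosSemidef →
      ‖(X * B).trace‖ ^ 2 ≤ (X * A).trace.re * (X * C).trace.re) :
    ‖B‖ ^ 2 ≤ A.trace.re * C.trace.re := by
  have key : ∀ ε : ℝ, 0 ≤ ε → IsUnit (B + (ε : ℂ) • 1) →
      ‖B + (ε : ℂ) • (1 : Matrix κ κ ℂ)‖ ^ 2 ≤
        (A + (ε : ℂ) • (1 : Matrix κ κ ℂ)).trace.re *
          (C + (ε : ℂ) • (1 : Matrix κ κ ℂ)).trace.re := by
    intro ε hε hu
    have hX : ∀ X : Matrix κ κ ℂ, X.PosSemidef → 0 ≤ X.trace.re ∧ ‖X.trace‖ = X.trace.re := by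
      intro X hX
      have := hX.trace_nonneg
      exact ⟨(Complex.nonneg_iff.1 this).1, by
        simpa using congrArg Complex.re (Complex.norm_of_nonneg' this)⟩
    have e : ∀ X D : Matrix κ κ ℂ, (X * (D + (ε : ℂ) • (1 : Matrix κ κ ℂ))).trace =
        (X * D).trace + ε * X.trace := fun X D => by
      simp [Matrix.mul_add]
    refine frobenius_norm_sq_le_of_isUnit hu (fun X hX' => ?_) (fun X hX' => ?_) fun X hX' => ?_
    · rw [e]
      have := hA X hX'
      have := mul_nonneg hε (hX X hX').1
      simp; linarith
    · rw [e]
      have := hC X hX'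
      have := mul_nonneg hε (hX X hX').1
      simp; linarith
    · rw [e, e, e]
      have ha := hA X hX'
      have hc := hC X hX'
      have hb := h X hX'
      have hx := mul_nonneg hε (hX X hX').1
      have hn : ‖(X * B).trace + ε * X.trace‖ ≤ ‖(X * B).trace‖ + ε * X.trace.re := by
        refine (norm_add_le _ _).trans_eq ?_
        rw [norm_mul, (hX X hX').2, Complex.norm_real, Real.norm_of_nonneg hε]
      -- AM–GM controls the cross term, linear in `ε`, of the perturbed inequality.
      have h2 : 2 * ‖(X * B).trace‖ ≤ (X * A).trace.re + (X * C).trace.re := by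
        refine le_of_sq_le_sq ?_ (by linarith)
        nlinarith [sq_nonneg ((X * A).trace.re - (X * C).trace.re)]
      refine (pow_le_pow_left₀ (norm_nonneg _) hn 2).trans ?_
      simp only [Complex.add_re, Complex.mul_re, Complex.ofReal_re, Complex.ofReal_im, zero_mul,
        sub_zero]
      nlinarith
  -- `B + ε • 1` is singular only when `-ε` is an eigenvalue, so small positive `ε` are all
  -- admissible.
  have hfin : {ε : ℝ | (-ε : ℂ) ∈ spectrum ℂ B}.Finite :=
    (Matrix.finite_spectrum B).preimage (fun a _ b _ hab => by simpa using hab)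
  have hev : ∀ᶠ ε : ℝ in nhdsWithin 0 (Set.Ioi 0), IsUnit (B + (ε : ℂ) • (1 : Matrix κ κ ℂ)) := by
    have h1 : ∀ᶠ ε : ℝ in nhdsWithin 0 (Set.Ioi 0),
        ε ∉ {ε : ℝ | (-ε : ℂ) ∈ spectrum ℂ B} \ {0} := by
      refine nhdsWithin_le_nhds ?_
      exact (hfin.subset Set.sdiff_subset).isClosed.isOpen_compl.mem_nhds (by simp)
    filter_upwards [h1, self_mem_nhdsWithin] with ε h2 h3
    have h4 : (-ε : ℂ) ∉ spectrum ℂ B := fun h => h2 ⟨h, ne_of_gt h3⟩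
    rw [spectrum.notMem_iff, Algebra.algebraMap_eq_smul_one] at h4
    have := h4.neg
    rwa [neg_sub, neg_smul, sub_neg_eq_add] at this
  have hl : Filter.Tendsto (fun ε : ℝ => ‖B + (ε : ℂ) • (1 : Matrix κ κ ℂ)‖ ^ 2)
      (nhdsWithin 0 (Set.Ioi 0)) (nhds (‖B‖ ^ 2)) := by
    have hc : Continuous fun ε : ℝ => ‖B + (ε : ℂ) • (1 : Matrix κ κ ℂ)‖ ^ 2 := by fun_prop
    simpa using (hc.tendsto 0).mono_left nhdsWithin_le_nhds
  have hr : Filter.Tendsto (fun ε : ℝ => (A + (ε : ℂ) • (1 : Matrix κ κ ℂ)).trace.re *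
          (C + (ε : ℂ) • (1 : Matrix κ κ ℂ)).trace.re)
      (nhdsWithin 0 (Set.Ioi 0)) (nhds (A.trace.re * C.trace.re)) := by
    have hc : Continuous fun ε : ℝ => (A.trace + (ε : ℂ) * Fintype.card κ).re *
        (C.trace + (ε : ℂ) * Fintype.card κ).re := by fun_prop
    simpa [trace_add, trace_smul] using (hc.tendsto 0).mono_left nhdsWithin_le_nhds
  refine le_of_tendsto_of_tendsto hl hr ?_
  filter_upwards [hev, self_mem_nhdsWithin] with ε h1 h2
  exact key ε (le_of_lt h2) h1
end Trace

/-! ### Block matrices, local compressions and norm bounds. -/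

section Blocks

variable {κ n : Type*} [Fintype n]

/-- The compression `∑ a b, conj (v a) * v b • W a b` of a block matrix along a local vector. -/
noncomputable def compress (W : n → n → Matrix κ κ ℂ) (v : n → ℂ) : Matrix κ κ ℂ :=
  ∑ a, ∑ b, (star (v a) * v b) • W a b

/-- The block matrix `W` in the local basis given by the columns of `V`. -/
noncomputable def changeBasis (W : n → n → Matrix κ κ ℂ) (V : Matrix n n ℂ) (i j : n) :
    Matrix κ κ ℂ :=
  ∑ a, ∑ b, (star (V a i) * V b j) • W a b

theorem compress_changeBasis (W : n → n → Matrix κ κ ℂ) (V : Matrix n n ℂ) (v : n → ℂ) :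
    compress (changeBasis W V) v = compress W (V *ᵥ v) := by
  have h : ∀ a b, star ((V *ᵥ v) a) * (V *ᵥ v) b =
      ∑ i, ∑ j, star (v i) * v j * (star (V a i) * V b j) := fun a b => by
    simp only [mulVec, dotProduct, star_sum, Finset.sum_mul_sum, star_mul']
    refine Finset.sum_congr rfl fun i _ => Finset.sum_congr rfl fun j _ => ?_
    ring
  simp only [compress, changeBasis, h, Finset.sum_smul, Finset.smul_sum, smul_smul]
  calc _ = ∑ i, ∑ a, ∑ j, ∑ b, (star (v i) * v j * (star (V a i) * V b j)) • W a b :=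
        Finset.sum_congr rfl fun i _ => Finset.sum_comm
    _ = ∑ a, ∑ i, ∑ b, ∑ j, (star (v i) * v j * (star (V a i) * V b j)) • W a b := by
        rw [Finset.sum_comm]
        exact Finset.sum_congr rfl fun a _ => Finset.sum_congr rfl fun i _ => Finset.sum_comm
    _ = _ := Finset.sum_congr rfl fun a _ => Finset.sum_comm

theorem changeBasis_apply (W : n → n → Matrix κ κ ℂ) (V : Matrix n n ℂ) (i j : n) (x y : κ) :
    changeBasis W V i j x y = (Vᴴ * (Matrix.of fun a b => W a b x y) * V) i j := by
  simp only [changeBasis, Matrix.sum_apply, Matrix.smul_apply, mul_apply, conjTranspose_apply,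
    of_apply, Finset.sum_mul, smul_eq_mul]
  rw [Finset.sum_comm]
  refine Finset.sum_congr rfl fun a _ => Finset.sum_congr rfl fun b _ => ?_
  ring

theorem compress_single [DecidableEq n] (W : n → n → Matrix κ κ ℂ) (i : n) :
    compress W (Pi.single i 1) = W i i := by
  unfold compress
  rw [Finset.sum_eq_single i, Finset.sum_eq_single i]
  · simp
  · intro b _ hb; simp [hb]
  · simp
  · intro b _ hb; simp [hb]
  · simp

theorem compress_single_add_single [DecidableEq n] (W : n → n → Matrix κ κ ℂ) {i j : n}
    (hij : i ≠ j) (s t : ℂ) :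
    compress W (Pi.single i s + Pi.single j t) = (star s * s) • W i i + (star t * t) • W j j +
      ((star s * t) • W i j + (star t * s) • W j i) := by
  have h : ∀ f : n → Matrix κ κ ℂ, (∀ a, a ≠ i → a ≠ j → f a = 0) → ∑ a, f a = f i + f j := by
    intro f hf
    rw [← Finset.sum_pair hij]
    refine (Finset.sum_subset (Finset.subset_univ _) fun a _ ha => ?_).symm
    simp only [Finset.mem_insert, Finset.mem_singleton, not_or] at ha
    exact hf a ha.1 ha.2
  unfold compress
  rw [h, h, h]
  · simp [hij, hij.symm]
    abel
  all_goals intro a h1 h2; simp [h1, h2]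

variable [Fintype κ]

theorem trace_changeBasis (W : n → n → Matrix κ κ ℂ) (V : Matrix n n ℂ) (i j : n) :
    (changeBasis W V i j).trace = (Vᴴ * (Matrix.of fun a b => (W a b).trace) * V) i j := by
  simp only [changeBasis, trace_sum, trace_smul, mul_apply, conjTranspose_apply, of_apply,
    Finset.sum_mul, smul_eq_mul]
  rw [Finset.sum_comm]
  refine Finset.sum_congr rfl fun a _ => Finset.sum_congr rfl fun b _ => ?_
  ring

theorem frobenius_norm_unitary_conj [DecidableEq n] {V : Matrix n n ℂ}
    (hV : V ∈ unitaryGroup n ℂ) (M : Matrix n n ℂ) : ‖Vᴴ * M * V‖ = ‖M‖ := by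
  have h1 : V * Vᴴ = 1 := Unitary.mul_star_self_of_mem hV
  have : ‖Vᴴ * M * V‖ ^ 2 = ‖M‖ ^ 2 := by
    rw [frobenius_norm_sq_eq_re_trace, frobenius_norm_sq_eq_re_trace]
    simp only [conjTranspose_mul, conjTranspose_conjTranspose, Matrix.mul_assoc]
    rw [← Matrix.mul_assoc V Vᴴ, h1, Matrix.one_mul, trace_mul_comm]
    simp only [Matrix.mul_assoc]
    rw [h1, Matrix.mul_one]
  exact (pow_left_inj₀ (norm_nonneg _) (norm_nonneg _) two_ne_zero).1 this

/-- For each fixed inner entry `(x, y)`, the change of basis is a unitary conjugation of the matrix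
of outer indices. -/
theorem sum_frobenius_norm_sq_changeBasis [DecidableEq n] (W : n → n → Matrix κ κ ℂ)
    {V : Matrix n n ℂ} (hV : V ∈ unitaryGroup n ℂ) :
    ∑ i, ∑ j, ‖changeBasis W V i j‖ ^ 2 = ∑ i, ∑ j, ‖W i j‖ ^ 2 := by
  have h : ∀ Z : n → n → Matrix κ κ ℂ, ∑ i, ∑ j, ‖Z i j‖ ^ 2 =
      ∑ x, ∑ y, ‖(Matrix.of fun a b => Z a b x y : Matrix n n ℂ)‖ ^ 2 := fun Z => by
    simp only [frobenius_norm_sq, of_apply]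
    calc _ = ∑ i, ∑ x, ∑ j, ∑ y, ‖Z i j x y‖ ^ 2 :=
          Finset.sum_congr rfl fun i _ => Finset.sum_comm
      _ = ∑ x, ∑ i, ∑ y, ∑ j, ‖Z i j x y‖ ^ 2 := by
          rw [Finset.sum_comm]
          exact Finset.sum_congr rfl fun a _ => Finset.sum_congr rfl fun i _ => Finset.sum_comm
      _ = _ := Finset.sum_congr rfl fun a _ => Finset.sum_comm
  rw [h, h]
  refine Finset.sum_congr rfl fun x _ => Finset.sum_congr rfl fun y _ => ?_
  have : (Matrix.of fun a b => changeBasis W V a b x y : Matrix n n ℂ) =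
      Vᴴ * (Matrix.of fun a b => W a b x y) * V := by
    ext i j
    rw [of_apply, changeBasis_apply]
  rw [this, frobenius_norm_unitary_conj hV]

theorem le_two_mul_of_forall_sq {β p q : ℝ} (hp : 0 ≤ p) (hq : 0 ≤ q)
    (h : ∀ x y : ℝ, 0 < x → 0 < y → 2 * (x * y) * β ≤ (x * p + y * q) ^ 2) : β ≤ 2 * p * q := by
  by_contra! hβ
  have hβ0 : 0 < β := lt_of_le_of_lt (by positivity) hβ
  rcases hp.eq_or_lt with rfl | hp'
  · have := h ((q ^ 2 + 1) / (2 * β)) 1 (by positivity) one_pos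
    field_simp at this
    nlinarith
  rcases hq.eq_or_lt with rfl | hq'
  · have := h 1 ((p ^ 2 + 1) / (2 * β)) one_pos (by positivity)
    field_simp at this
    nlinarith
  -- The weights `x = q`, `y = p` balance `x * p` and `y * q`.
  have := h q p hq' hp'
  nlinarith [mul_pos hp' hq']

/-- Compress along `√x eᵢ + √y z eⱼ` for `z = ±1, ±I`. Tracelessness makes the right-hand side
independent of `z`; the parallelogram law over the four phases isolates `‖W i j‖²`, and the weights
are then optimised. -/
theorem frobenius_norm_block_sq_le [DecidableEq n] {W : n → n → Matrix κ κ ℂ} {c : ℝ}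
    (hc : 0 ≤ c)
    (hW : ∀ a b, W b a = (W a b)ᴴ) (h : ∀ v, ‖compress W v‖ ≤ c * (compress W v).trace.re)
    (hpos : ∀ a, 0 ≤ (W a a).trace.re)
    {i j : n} (hij : i ≠ j) (h0 : (W i j).trace = 0) :
    ‖W i j‖ ^ 2 ≤ 2 * (c * (W i i).trace.re) * (c * (W j j).trace.re) := by
  have h0' : (W j i).trace = 0 := by rw [hW i j, trace_conjTranspose, h0, star_zero]
  refine le_two_mul_of_forall_sq (mul_nonneg hc (hpos i)) (mul_nonneg hc (hpos j))
    fun x y hx hy => ?_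
  have hsx : ((√x : ℝ) : ℂ) * (√x : ℝ) = (x : ℝ) := by
    rw [← Complex.ofReal_mul, Real.mul_self_sqrt hx.le]
  have hsy : ((√y : ℝ) : ℂ) * (√y : ℝ) = (y : ℝ) := by
    rw [← Complex.ofReal_mul, Real.mul_self_sqrt hy.le]
  set D : Matrix κ κ ℂ := (x : ℂ) • W i i + (y : ℂ) • W j j with hD
  set r : ℂ := ((√x * √y : ℝ) : ℂ) with hr
  have hr2 : ‖r‖ ^ 2 = x * y := by
    rw [hr, Complex.norm_real, Real.norm_of_nonneg (by positivity), mul_pow, Real.sq_sqrt hx.le,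
      Real.sq_sqrt hy.le]
  have key : ∀ z : ℂ, star z * z = 1 → ‖D + r • (z • W i j + star z • W j i)‖ ^ 2 ≤
      (x * (c * (W i i).trace.re) + y * (c * (W j j).trace.re)) ^ 2 := by
    intro z hz
    have e : compress W (Pi.single i ((√x : ℝ) : ℂ) + Pi.single j (((√y : ℝ) : ℂ) * z)) =
        D + r • (z • W i j + star z • W j i) := by
      rw [compress_single_add_single _ hij, hD, hr]
      have e1 : star (((√y : ℝ) : ℂ) * z) * (((√y : ℝ) : ℂ) * z) = (y : ℂ) := by
        rw [star_mul', ← hsy]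
        calc _ = star ((√y : ℝ) : ℂ) * ((√y : ℝ) : ℂ) * (star z * z) := by ring
          _ = _ := by rw [hz, mul_one]; simp
      rw [e1]
      simp only [Complex.star_def, Complex.conj_ofReal, hsx, map_mul, Complex.ofReal_mul, smul_add,
        smul_smul]
      congr 3
      · ring
      · ring
    have hv := h (Pi.single i ((√x : ℝ) : ℂ) + Pi.single j (((√y : ℝ) : ℂ) * z))
    rw [e] at hv
    refine pow_le_pow_left₀ (norm_nonneg _) (hv.trans_eq ?_) 2
    simp [hD, h0, h0']
    ring
  have k1 := key 1 (by simp)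
  have k2 := key (-1) (by simp)
  have k3 := key Complex.I (by simp)
  have k4 := key (-Complex.I) (by simp)
  have p1 := frobenius_parallelogram D (r • (W i j + W j i))
  have p2 := frobenius_parallelogram D (r • (Complex.I • (W i j - W j i)))
  have p3 := frobenius_parallelogram (W i j) (W j i)
  have e1 : D + r • ((1 : ℂ) • W i j + star (1 : ℂ) • W j i) = D + r • (W i j + W j i) := by simp
  have e2 : D + r • ((-1 : ℂ) • W i j + star (-1 : ℂ) • W j i) = D - r • (W i j + W j i) := by
    simp only [star_neg, star_one]; module
  have e3 : D + r • (Complex.I • W i j + star Complex.I • W j i) =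
      D + r • (Complex.I • (W i j - W j i)) := by
    simp only [Complex.star_def, Complex.conj_I]; module
  have e4 : D + r • ((-Complex.I) • W i j + star (-Complex.I) • W j i) =
      D - r • (Complex.I • (W i j - W j i)) := by
    simp only [Complex.star_def, map_neg, Complex.conj_I]; module
  rw [e1] at k1
  rw [e2] at k2
  rw [e3] at k3
  rw [e4] at k4
  rw [norm_smul, mul_pow, hr2] at p1
  rw [norm_smul, mul_pow, hr2, norm_smul, Complex.norm_I, one_mul] at p2
  have e5 : ‖W j i‖ = ‖W i j‖ := by rw [hW i j, frobenius_norm_conjTranspose]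
  rw [e5] at p3
  nlinarith [sq_nonneg ‖D‖]

/-- The norm bound for witnesses gains a factor `√(2 - 1/d)` when a local system is added. -/
theorem sum_frobenius_norm_sq_le [DecidableEq n] {W : n → n → Matrix κ κ ℂ} {c : ℝ}
    (hc : 0 < c) (hW : ∀ a b, W b a = (W a b)ᴴ)
    (h : ∀ v, ‖compress W v‖ ≤ c * (compress W v).trace.re) :
    ∑ i, ∑ j, ‖W i j‖ ^ 2 ≤
      (2 - 1 / (Fintype.card n : ℝ)) * c ^ 2 * (∑ i, (W i i).trace.re) ^ 2 := by
  -- Diagonalising this matrix of block traces makes every off-diagonal block traceless in the new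
  -- basis.
  set P : Matrix n n ℂ := Matrix.of fun a b => (W a b).trace with hP
  have hPH : P.IsHermitian := by
    ext a b
    rw [conjTranspose_apply, hP, of_apply, of_apply, hW b a, trace_conjTranspose]
  set V : Matrix n n ℂ := (hPH.eigenvectorUnitary : Matrix n n ℂ)
  have hV : V ∈ unitaryGroup n ℂ := hPH.eigenvectorUnitary.2
  have hdiag : Vᴴ * P * V = diagonal (RCLike.ofReal ∘ hPH.eigenvalues) := by
    have := hPH.conjStarAlgAut_star_eigenvectorUnitary
    rwa [Unitary.conjStarAlgAut_star_apply] at this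
  set Z := changeBasis W V with hZ
  have hZtr : ∀ i j, (Z i j).trace = diagonal (RCLike.ofReal ∘ hPH.eigenvalues) i j :=
    fun i j => by rw [hZ, trace_changeBasis, ← hP, hdiag]
  have hZH : ∀ a b, Z b a = (Z a b)ᴴ := fun a b => by
    simp only [hZ, changeBasis, conjTranspose_sum, conjTranspose_smul]
    rw [Finset.sum_comm]
    refine Finset.sum_congr rfl fun i _ => Finset.sum_congr rfl fun j _ => ?_
    rw [← hW, star_mul', star_star, mul_comm]
  have hZc : ∀ v, ‖compress Z v‖ ≤ c * (compress Z v).trace.re := fun v => by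
    rw [hZ, compress_changeBasis]; exact h _
  have hd : ∀ i, ‖Z i i‖ ≤ c * (Z i i).trace.re := fun i => by
    simpa [compress_single] using hZc (Pi.single i 1)
  have hpos : ∀ i, 0 ≤ (Z i i).trace.re := fun i =>
    nonneg_of_mul_nonneg_right ((norm_nonneg _).trans (hd i)) hc
  set p : n → ℝ := fun i => c * (Z i i).trace.re with hp
  have hsum : ∑ i, (W i i).trace.re = ∑ i, (Z i i).trace.re := by
    have h1 : (Vᴴ * P * V).trace = P.trace := by
      rw [trace_mul_cycle, show V * Vᴴ = 1 from Unitary.mul_star_self_of_mem hV, Matrix.one_mul]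
    have h2 := congrArg Complex.re h1
    rw [hdiag] at h2
    simp only [trace, diag, Complex.re_sum] at h2
    simp only [hZtr]
    exact h2.symm
  rw [hsum, ← sum_frobenius_norm_sq_changeBasis W hV, ← hZ, mul_assoc, ← mul_pow, Finset.mul_sum]
  change _ ≤ (2 - 1 / (Fintype.card n : ℝ)) * (∑ i, p i) ^ 2
  have hle : ∀ i j, ‖Z i j‖ ^ 2 ≤ 2 * (p i * p j) - if i = j then p i ^ 2 else 0 := by
    intro i j
    split_ifs with hij
    · subst hij
      have := pow_le_pow_left₀ (norm_nonneg _) (hd i) 2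
      simp only [hp]
      nlinarith
    · have := frobenius_norm_block_sq_le hc.le hZH hZc hpos hij
        (by rw [hZtr, diagonal_apply_ne _ hij])
      rw [sub_zero]
      linarith
  -- The diagonal blocks lack the factor 2; this saving is the `-1/d` in the constant.
  have hcs : (∑ i, p i) ^ 2 / (Fintype.card n : ℝ) ≤ ∑ i, p i ^ 2 := by
    refine div_le_of_le_mul₀ (by positivity) (by positivity) ?_
    rw [mul_comm]
    simpa using sq_sum_le_card_mul_sum_sq (s := Finset.univ) (f := p)
  calc ∑ i, ∑ j, ‖Z i j‖ ^ 2
      ≤ ∑ i, ∑ j, (2 * (p i * p j) - if i = j then p i ^ 2 else 0) :=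
        Finset.sum_le_sum fun i _ => Finset.sum_le_sum fun j _ => hle i j
    _ = 2 * (∑ i, p i) ^ 2 - ∑ i, p i ^ 2 := by
        simp only [Finset.sum_sub_distrib, Finset.sum_ite_eq, Finset.mem_univ, if_true,
          ← Finset.mul_sum, ← Finset.sum_mul, sq]
    _ ≤ 2 * (∑ i, p i) ^ 2 - (∑ i, p i) ^ 2 / (Fintype.card n : ℝ) := by linarith
    _ = _ := by ring

/-- The norm bound for witnesses of bipartite separability. -/
theorem sum_frobenius_norm_sq_le_of_compress [DecidableEq κ] [DecidableEq n]
    {W : n → n → Matrix κ κ ℂ}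
    (hW : ∀ a b, W b a = (W a b)ᴴ)
    (h : ∀ v, ∀ X : Matrix κ κ ℂ, X.PosSemidef → 0 ≤ (X * compress W v).trace.re) :
    ∑ i, ∑ j, ‖W i j‖ ^ 2 ≤ (∑ i, (W i i).trace.re) ^ 2 := by
  -- `X ↦ (tr (X W a b))` is a positive map; its 2×2 minors feed `frobenius_norm_sq_le_of_trace`.
  have hQ : ∀ X : Matrix κ κ ℂ, X.PosSemidef →
      (Matrix.of fun a b => (X * W a b).trace : Matrix n n ℂ).PosSemidef := by
    intro X hX
    have hH : (Matrix.of fun a b => (X * W a b).trace : Matrix n n ℂ).IsHermitian := by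
      ext a b
      rw [conjTranspose_apply, of_apply, of_apply, hW b a, ← trace_conjTranspose,
        conjTranspose_mul, hX.1.eq, trace_mul_comm]
    refine PosSemidef.of_dotProduct_mulVec_nonneg hH fun v => ?_
    have e : star v ⬝ᵥ (Matrix.of fun a b => (X * W a b).trace : Matrix n n ℂ) *ᵥ v =
        (X * compress W v).trace := by
      simp only [compress, trace_sum, Matrix.mul_smul, trace_smul, dotProduct,
        mulVec, of_apply, Finset.mul_sum, Pi.star_apply, smul_eq_mul]
      refine Finset.sum_congr rfl fun i _ => Finset.sum_congr rfl fun j _ => ?_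
      ring
    rw [Complex.nonneg_iff]
    refine ⟨e ▸ h v X hX, ?_⟩
    have := hH.im_star_dotProduct_mulVec_self v
    exact this.symm
  have hb : ∀ i j, ‖W i j‖ ^ 2 ≤ (W i i).trace.re * (W j j).trace.re := by
    intro i j
    have hd : ∀ i, ∀ X : Matrix κ κ ℂ, X.PosSemidef → 0 ≤ (X * W i i).trace.re :=
      fun i X hX => by simpa [compress_single] using h (Pi.single i 1) X hX
    exact frobenius_norm_sq_le_of_trace (hd i) (hd j)
      fun X hX => PosSemidef.norm_apply_sq_le (hQ X hX) i j
  refine (Finset.sum_le_sum fun i _ => Finset.sum_le_sum fun j _ => hb i j).trans_eq ?_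
  rw [sq, Finset.sum_mul_sum]

end Blocks

/-! ### Entanglement witnesses and their norm bound. -/

section Witness

/-- Entanglement witnesses: Hermitian matrices nonnegative on products of positive semidefinite
matrices. -/
def IsWitness {m d : ℕ} (W : MultiMatrix (fun _ : Fin m => d)) : Prop :=
  W.IsHermitian ∧ ∀ A : Fin m → Matrix (Fin d) (Fin d) ℂ, (∀ k, (A k).PosSemidef) →
    0 ≤ (tensor A * W).trace.re

/-- The blocks of a multipartite matrix with respect to the first local system. -/
def block {m d : ℕ} (W : MultiMatrix (fun _ : Fin (m + 1) => d)) (a b : Fin d) :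
    MultiMatrix (fun _ : Fin m => d) :=
  Matrix.of fun x y => W (Fin.cons (α := fun _ => Fin d) a x) (Fin.cons (α := fun _ => Fin d) b y)

theorem sum_fin_cons {m d : ℕ} {M : Type*} [AddCommMonoid M] (f : (Fin (m + 1) → Fin d) → M) :
    ∑ i, f i = ∑ a, ∑ x : Fin m → Fin d, f (Fin.cons (α := fun _ => Fin d) a x) := by
  rw [← (Fin.consEquiv fun _ : Fin (m + 1) => Fin d).sum_comp, Fintype.sum_prod_type]
  rfl

theorem tensor_cons {m d : ℕ} (B : Matrix (Fin d) (Fin d) ℂ)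
    (A : Fin m → Matrix (Fin d) (Fin d) ℂ) (a b : Fin d) (x y : Fin m → Fin d) :
    tensor (d := fun _ => d)
      (Fin.cons (α := fun _ => Matrix (Fin d) (Fin d) ℂ) B A) (Fin.cons (α := fun _ => Fin d) a x)
      (Fin.cons (α := fun _ => Fin d) b y) = B a b * tensor (d := fun _ => d) A x y := by
  simp [tensor, Fin.prod_univ_succ]

theorem trace_eq_sum_block {m d : ℕ} (W : MultiMatrix (fun _ : Fin (m + 1) => d)) :
    W.trace = ∑ a, (block W a a).trace :=
  sum_fin_cons fun i => W i i

theorem frobenius_norm_sq_eq_sum_block {m d : ℕ} (W : MultiMatrix (fun _ : Fin (m + 1) => d)) :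
    ‖W‖ ^ 2 = ∑ a, ∑ b, ‖block W a b‖ ^ 2 := by
  rw [frobenius_norm_sq]
  refine (sum_fin_cons _).trans ?_
  refine Finset.sum_congr rfl fun a _ => ?_
  have h : ∀ x, ∑ j, ‖W (Fin.cons (α := fun _ => Fin d) a x) j‖ ^ 2 =
      ∑ b, ∑ y, ‖block W a b x y‖ ^ 2 := fun x =>
    sum_fin_cons fun j => ‖W (Fin.cons (α := fun _ => Fin d) a x) j‖ ^ 2
  simp only [h, frobenius_norm_sq]
  exact Finset.sum_comm

/-- Testing with a rank-one matrix in the first slot is what makes compressions of witnesses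
witnesses. -/
theorem trace_tensor_cons_mul {m d : ℕ} (W : MultiMatrix (fun _ : Fin (m + 1) => d))
    (A : Fin m → Matrix (Fin d) (Fin d) ℂ) (v : Fin d → ℂ) :
    (tensor (d := fun _ => d) (Fin.cons (α := fun _ => Matrix (Fin d) (Fin d) ℂ)
      (vecMulVec v (star v)) A) * W).trace =
      (tensor (d := fun _ => d) A * compress (block W) v).trace := by
  simp only [trace, diag, mul_apply]
  rw [sum_fin_cons]
  simp only [fun a x => sum_fin_cons fun j => tensor (d := fun _ => d)
    (Fin.cons (α := fun _ => Matrix (Fin d) (Fin d) ℂ) (vecMulVec v (star v)) A)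
      (Fin.cons (α := fun _ => Fin d) a x) j * W j (Fin.cons (α := fun _ => Fin d) a x),
    tensor_cons, compress, Matrix.sum_apply, Matrix.smul_apply, Finset.mul_sum]
  rw [Finset.sum_comm]
  refine Finset.sum_congr rfl fun x _ => ?_
  refine ((Finset.sum_congr rfl fun a _ => Finset.sum_comm).trans Finset.sum_comm).trans ?_
  refine Finset.sum_congr rfl fun y _ => Finset.sum_comm.trans ?_
  refine Finset.sum_congr rfl fun b _ => Finset.sum_congr rfl fun a _ => ?_
  simp only [vecMulVec_apply, block, of_apply, smul_eq_mul, Pi.star_apply]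
  ring

theorem IsWitness.block_conjTranspose {m d : ℕ} {W : MultiMatrix (fun _ : Fin (m + 1) => d)}
    (hW : IsWitness W) (a b : Fin d) : block W b a = (block W a b)ᴴ := by
  ext x y
  simp only [block, conjTranspose_apply, of_apply]
  exact (hW.1.apply _ _).symm

theorem IsWitness.compress_block {m d : ℕ} {W : MultiMatrix (fun _ : Fin (m + 1) => d)}
    (hW : IsWitness W) (v : Fin d → ℂ) : IsWitness (compress (block W) v) := by
  refine ⟨?_, fun A hA => ?_⟩
  · simp only [IsHermitian, compress, conjTranspose_sum, conjTranspose_smul]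
    rw [Finset.sum_comm]
    refine Finset.sum_congr rfl fun i _ => Finset.sum_congr rfl fun j _ => ?_
    rw [← hW.block_conjTranspose, star_mul', star_star, mul_comm]
  · rw [← trace_tensor_cons_mul]
    refine hW.2 _ fun k => ?_
    refine Fin.cases ?_ (fun k => ?_) k
    · exact posSemidef_vecMulVec_self_star v
    · exact hA k

theorem exists_tensor_eq_of_posSemidef {d : ℕ} {X : MultiMatrix (fun _ : Fin 1 => d)}
    (hX : X.PosSemidef) : ∃ A : Fin 1 → Matrix (Fin d) (Fin d) ℂ, (∀ k, (A k).PosSemidef) ∧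
      X = tensor (d := fun _ => d) A := by
  refine ⟨fun _ => X.submatrix (fun i _ => i) (fun i _ => i), fun k => hX.submatrix _, ?_⟩
  ext i j
  have h : ∀ i : Fin 1 → Fin d, (fun _ => i 0) = i := fun i => by
    ext k; rw [Subsingleton.elim k 0]
  simp [tensor, h]

theorem IsWitness.re_trace_nonneg {m d : ℕ} {W : MultiMatrix (fun _ : Fin m => d)}
    (hW : IsWitness W) : 0 ≤ W.trace.re := by
  have h1 : tensor (d := fun _ : Fin m => d) (fun _ => 1) = 1 := by
    ext i j
    simp only [tensor, of_apply, one_apply]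
    by_cases h : i = j
    · simp [h]
    · obtain ⟨k, hk⟩ := Function.ne_iff.1 h
      rw [if_neg h]
      exact Finset.prod_eq_zero (Finset.mem_univ k) (if_neg hk)
  have := hW.2 (fun _ => 1) fun _ => PosSemidef.one
  rwa [h1, Matrix.one_mul] at this

theorem IsWitness.frobenius_norm_le {d : ℕ} (hd : 1 ≤ d) (m : ℕ)
    {W : MultiMatrix (fun _ : Fin (m + 2) => d)} (hW : IsWitness W) :
    ‖W‖ ≤ √(2 - 1 / (d : ℝ)) ^ m * W.trace.re := by
  have hd' : (1 : ℝ) ≤ d := by exact_mod_cast hd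
  have hK : 0 < 2 - 1 / (d : ℝ) := by
    have : 1 / (d : ℝ) ≤ 1 := by rw [div_le_one (by linarith)]; exact hd'
    linarith
  have htr : ∀ {m : ℕ} (W : MultiMatrix (fun _ : Fin (m + 1) => d)),
      ∑ a, (block W a a).trace.re = W.trace.re := fun W => by
    rw [trace_eq_sum_block, Complex.re_sum]
  induction m with
  | zero =>
    rw [pow_zero, one_mul]
    refine le_of_sq_le_sq ?_ hW.re_trace_nonneg
    rw [frobenius_norm_sq_eq_sum_block, ← htr]
    refine sum_frobenius_norm_sq_le_of_compress hW.block_conjTranspose fun v X hX => ?_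
    obtain ⟨A, hA, rfl⟩ := exists_tensor_eq_of_posSemidef hX
    exact (hW.compress_block v).2 A hA
  | succ m ih =>
    have hc : 0 < √(2 - 1 / (d : ℝ)) ^ m := pow_pos (Real.sqrt_pos.2 hK) m
    refine le_of_sq_le_sq ?_ (mul_nonneg (by positivity) hW.re_trace_nonneg)
    rw [frobenius_norm_sq_eq_sum_block]
    refine (sum_frobenius_norm_sq_le hc hW.block_conjTranspose
      fun v => ih (hW.compress_block v)).trans_eq ?_
    have hs := Real.sq_sqrt hK.le
    have hs' : (√(2 - 1 / (d : ℝ)) ^ (m + 1)) ^ 2 =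
        (2 - 1 / (d : ℝ)) * (√(2 - 1 / (d : ℝ)) ^ m) ^ 2 := by
      rw [pow_succ _ m, mul_pow, hs, mul_comm]
    rw [htr, Fintype.card_fin, mul_pow, hs']

end Witness

/-! ### Duality between separable matrices and witnesses. -/

section Duality

/-- The convex hull of a compact set in a finite-dimensional space is compact. -/
theorem isCompact_convexHull_of_finiteDimensional {E : Type*} [NormedAddCommGroup E]
    [NormedSpace ℝ E] [FiniteDimensional ℝ E] {s : Set E} (hs : IsCompact s) :
    IsCompact (convexHull ℝ s) := by
  -- Carathéodory: combinations of at most `N` points suffice, so the hull is a finite union of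
  -- compact images.
  let N := Module.finrank ℝ E + 1
  let T : Set E := ⋃ k ∈ Finset.range (N + 1),
    (fun q : (Fin k → ℝ) × (Fin k → E) => ∑ i, q.1 i • q.2 i) ''
      (stdSimplex ℝ (Fin k) ×ˢ Set.univ.pi fun _ => s)
  have hT : IsCompact T := by
    refine (Finset.range (N + 1)).isCompact_biUnion fun k _ => ?_
    exact ((isCompact_stdSimplex ℝ (Fin k)).prod (isCompact_univ_pi fun _ => hs)).image
      (by fun_prop)
  have e : convexHull ℝ s = T := by
    refine Set.Subset.antisymm (fun x hx => ?_) (Set.iUnion₂_subset fun k _ => ?_)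
    · obtain ⟨ι, _, z, w, hz, hai, hw, hw1, rfl⟩ := eq_pos_convex_span_of_mem_convexHull hx
      let e := Fintype.equivFin ι
      refine Set.mem_iUnion₂.2 ⟨Fintype.card ι, ?_, ⟨(w ∘ e.symm, z ∘ e.symm), ⟨⟨?_, ?_⟩, ?_⟩, ?_⟩⟩
      · exact Finset.mem_range_succ_iff.2 (hai.card_le_finrank_succ.trans
          (Nat.succ_le_succ (Submodule.finrank_le _)))
      · exact fun i => (hw _).le
      · exact (e.symm.sum_comp w).trans hw1
      · exact fun i _ => hz ⟨_, rfl⟩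
      · exact e.symm.sum_comp fun i => w i • z i
    · rintro _ ⟨⟨w, z⟩, ⟨⟨hw, hw1⟩, hz⟩, rfl⟩
      exact (convex_convexHull ℝ s).sum_mem (fun i _ => hw i) hw1
        fun i _ => subset_convexHull ℝ s (hz i (Set.mem_univ i))
  rw [e]
  exact hT

/-- Density matrices: positive semidefinite matrices of trace one. -/
def densityMatrices (d : ℕ) : Set (Matrix (Fin d) (Fin d) ℂ) :=
  {A | A.PosSemidef ∧ A.trace = 1}

theorem isCompact_densityMatrices (d : ℕ) : IsCompact (densityMatrices d) := by
  have hprop : ProperSpace (Matrix (Fin d) (Fin d) ℂ) := FiniteDimensional.proper ℂ _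
  refine Metric.isCompact_of_isClosed_isBounded ?_ ?_
  · have e : densityMatrices d = {A | Aᴴ = A} ∩ (⋂ x : Fin d → ℂ, {A | 0 ≤ star x ⬝ᵥ A *ᵥ x}) ∩
        {A | A.trace = 1} := by
      ext A
      simp [densityMatrices, posSemidef_iff_dotProduct_mulVec, IsHermitian]
    rw [e]
    refine ((isClosed_eq (by fun_prop) (by fun_prop)).inter (isClosed_iInter fun x => ?_)).inter
      (isClosed_eq (by fun_prop) (by fun_prop))
    exact isClosed_le (by fun_prop) (by fun_prop)
  · refine (Metric.isBounded_closedBall (x := 0) (r := 1)).subset fun A hA => ?_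
    rw [mem_closedBall_zero_iff]
    refine (PosSemidef.frobenius_norm_le_re_trace hA.1).trans_eq ?_
    rw [hA.2, Complex.one_re]

theorem isCompact_tensor_densityMatrices (m d : ℕ) :
    IsCompact (tensor (d := fun _ : Fin m => d) '' Set.univ.pi fun _ => densityMatrices d) := by
  refine (isCompact_univ_pi fun _ => isCompact_densityMatrices d).image ?_
  refine continuous_matrix fun i j => ?_
  simp only [tensor, of_apply]
  exact continuous_finsetProd _ fun k _ =>
    (continuous_apply k).matrix_elem _ _

theorem trace_tensor {m d : ℕ} (A : Fin m → Matrix (Fin d) (Fin d) ℂ) :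
    (tensor (d := fun _ => d) A).trace = ∏ k, (A k).trace := by
  simp only [trace, diag, tensor, of_apply]
  exact (Fintype.prod_sum fun k i => A k i i).symm

theorem tensor_smul {m d : ℕ} (c : Fin m → ℂ) (A : Fin m → Matrix (Fin d) (Fin d) ℂ) :
    tensor (d := fun _ => d) (fun k => c k • A k) = (∏ k, c k) • tensor (d := fun _ => d) A := by
  ext i j
  simp [tensor, Finset.prod_mul_distrib]

theorem exists_re_trace_mul_eq {ι : Type*} [Fintype ι] [DecidableEq ι]
    (f : Matrix ι ι ℂ →ₗ[ℝ] ℝ) : ∃ W : Matrix ι ι ℂ, ∀ X, f X = (X * W).trace.re := by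
  refine ⟨Matrix.of fun j i => (f (single i j 1) : ℂ) - (f (single i j Complex.I)) * Complex.I,
    fun X => ?_⟩
  conv_lhs => rw [matrix_eq_sum_single X]
  simp only [map_sum, trace, diag, mul_apply, Complex.re_sum]
  refine Finset.sum_congr rfl fun i _ => Finset.sum_congr rfl fun j _ => ?_
  have e : single i j (X i j) =
      (X i j).re • single i j (1 : ℂ) + (X i j).im • single i j Complex.I := by
    rw [smul_single, smul_single, ← single_add]
    congr 1
    apply Complex.ext <;> simp
  rw [e, map_add, map_smul, map_smul]
  simp

theorem exists_isHermitian_re_trace_mul_eq {ι : Type*} [Fintype ι] [DecidableEq ι]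
    (f : Matrix ι ι ℂ →ₗ[ℝ] ℝ) : ∃ W : Matrix ι ι ℂ, W.IsHermitian ∧
      ∀ X : Matrix ι ι ℂ, X.IsHermitian → f X = (X * W).trace.re := by
  obtain ⟨W, hW⟩ := exists_re_trace_mul_eq f
  refine ⟨(1 / 2 : ℝ) • (W + Wᴴ), ?_, fun X hX => ?_⟩
  · simp [IsHermitian, add_comm]
  · have : (X * Wᴴ).trace.re = (X * W).trace.re := by
      have h := trace_conjTranspose (W * X)
      rw [conjTranspose_mul, hX.eq, trace_mul_comm W] at h
      rw [h]; simp
    rw [hW]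
    simp only [Matrix.mul_smul, Matrix.mul_add, trace_smul, trace_add, Complex.smul_re,
      Complex.add_re, this, smul_eq_mul]
    ring

theorem tensor_isHermitian {m d : ℕ} {A : Fin m → Matrix (Fin d) (Fin d) ℂ}
    (hA : ∀ k, (A k).IsHermitian) : (tensor (d := fun _ => d) A).IsHermitian := by
  ext i j
  simp only [conjTranspose_apply, tensor, of_apply, star_prod]
  exact Finset.prod_congr rfl fun k _ => (hA k).apply _ _

/-- A positive semidefinite matrix that is nonnegative on all witnesses is separable. -/
theorem isSeparable_of_forall_isWitness {m d : ℕ}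
    {ρ : MultiMatrix (fun _ : Fin m => d)} (hρ : ρ.PosSemidef)
    (h : ∀ W, IsWitness W → 0 ≤ (ρ * W).trace.re) : IsSeparable (fun _ : Fin m => d) ρ := by
  by_cases h0 : ρ = 0
  · rw [h0]; exact Submodule.zero_mem _
  have htr : 0 < ρ.trace.re := by
    have h1 := Complex.nonneg_iff.1 hρ.trace_nonneg
    refine lt_of_le_of_ne h1.1 fun h2 => h0 (hρ.trace_eq_zero_iff.1 ?_)
    exact Complex.ext h2.symm h1.2.symm
  set K := tensor (d := fun _ : Fin m => d) '' Set.univ.pi fun _ => densityMatrices d with hK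
  set t := ρ.trace.re
  have hsub : convexHull ℝ K ⊆ (separableCone (d := fun _ : Fin m => d) fun _ => psdCone d) := by
    refine convexHull_min ?_ (PointedCone.convex _)
    rintro _ ⟨A, hA, rfl⟩
    exact Submodule.subset_span ⟨A, fun k => (hA k (Set.mem_univ k)).1, rfl⟩
  by_cases hmem : t⁻¹ • ρ ∈ convexHull ℝ K
  · have : ρ = (⟨t, htr.le⟩ : {c : ℝ // 0 ≤ c}) • (t⁻¹ • ρ) := by
      change ρ = t • (t⁻¹ • ρ)
      rw [smul_smul, mul_inv_cancel₀ htr.ne', one_smul]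
    unfold IsSeparable
    rw [this]
    exact Submodule.smul_mem _ _ (hsub hmem)
  exfalso
  have : FiniteDimensional ℝ (MultiMatrix (fun _ : Fin m => d)) :=
    FiniteDimensional.trans ℝ ℂ _
  obtain ⟨f, u, hfρ, hfK⟩ := geometric_hahn_banach_point_closed (convex_convexHull ℝ K)
    (isCompact_convexHull_of_finiteDimensional (isCompact_tensor_densityMatrices m d)).isClosed hmem
  obtain ⟨W₀, hW₀, hf⟩ := exists_isHermitian_re_trace_mul_eq
    (f : MultiMatrix (fun _ : Fin m => d) →ₗ[ℝ] ℝ)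
  -- On trace-one matrices, subtracting `u • 1` moves the separating threshold from `u` to `0`.
  set W : MultiMatrix (fun _ : Fin m => d) := W₀ - u • 1 with hWdef
  have hWtr : ∀ X : MultiMatrix (fun _ : Fin m => d), X.IsHermitian →
      (X * W).trace.re = f X - u * X.trace.re := fun X hX => by
    rw [hWdef, Matrix.mul_sub, trace_sub, Complex.sub_re, ← hf X hX]
    simp
  have hW : IsWitness W := by
    refine ⟨hW₀.sub (by simp [IsHermitian]), fun A hA => ?_⟩
    -- A factor of trace zero vanishes; otherwise every factor can be normalised to a density
    -- matrix.
    by_cases hz : ∃ k, (A k).trace = 0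
    · obtain ⟨k, hk⟩ := hz
      have hAk := (hA k).trace_eq_zero_iff.1 hk
      have : tensor (d := fun _ => d) A = 0 := by
        ext i j
        exact Finset.prod_eq_zero (Finset.mem_univ k) (by simp [hAk])
      simp [this]
    push Not at hz
    have hre : ∀ k, 0 < (A k).trace := fun k =>
      lt_of_le_of_ne (hA k).trace_nonneg (hz k).symm
    set B : Fin m → Matrix (Fin d) (Fin d) ℂ := fun k => (A k).trace⁻¹ • A k
    have hB : ∀ k, B k ∈ densityMatrices d := fun k =>
      ⟨(hA k).smul (inv_nonneg.2 (hre k).le), by simp [B, hz k]⟩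
    have hAB : tensor (d := fun _ => d) A =
        (∏ k, (A k).trace) • tensor (d := fun _ => d) B := by
      rw [← tensor_smul]
      congr 1
      ext1 k
      simp [B, smul_smul, hz k]
    have hpos : 0 ≤ (tensor (d := fun _ => d) B * W).trace.re := by
      rw [hWtr _ (tensor_isHermitian fun k => (hB k).1.1), trace_tensor,
        Finset.prod_eq_one fun k _ => (hB k).2, Complex.one_re, mul_one]
      exact sub_nonneg.2 (hfK _ (subset_convexHull ℝ K ⟨B, fun k _ => hB k, rfl⟩)).le
    have hp : 0 ≤ ∏ k, (A k).trace := Finset.prod_nonneg fun k _ => (hre k).le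
    rw [hAB, Matrix.smul_mul, trace_smul, smul_eq_mul, Complex.mul_re,
      ← (Complex.nonneg_iff.1 hp).2, zero_mul, sub_zero]
    exact mul_nonneg (Complex.nonneg_iff.1 hp).1 hpos
  have h1 := h W hW
  rw [hWtr ρ hρ.1] at h1
  rw [map_smul, smul_eq_mul, inv_mul_lt_iff₀ htr] at hfρ
  linarith

end Duality

end Multipartite

/-! ### The separable ball. -/

theorem mainTheorem2 (m d₀ : ℕ) (hm : 1 ≤ m) (hd₀ : 1 ≤ d₀)
    (ρ : Multipartite.MultiMatrix (fun _ : Fin m => d₀)) (hρ : ρ.PosSemidef)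
    (hball : ‖ρ - 1‖ ≤ ((d₀ : ℝ) / (2 * (d₀ : ℝ) - 1)) ^ ((m : ℝ) / 2 - 1)) :
    Multipartite.IsSeparable (fun _ : Fin m => d₀) ρ := by
  -- The witness bound starts at two parties; with one party, positive semidefinite already means
  -- separable.
  obtain rfl | ⟨k, rfl⟩ : m = 1 ∨ ∃ k, m = k + 2 := by
    rcases m with _ | _ | k
    · omega
    · exact Or.inl rfl
    · exact Or.inr ⟨k, rfl⟩
  · obtain ⟨A, hA, rfl⟩ := Multipartite.exists_tensor_eq_of_posSemidef hρ
    exact Submodule.subset_span ⟨A, hA, rfl⟩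
  refine Multipartite.isSeparable_of_forall_isWitness hρ fun W hW => ?_
  have hd : (1 : ℝ) ≤ d₀ := by exact_mod_cast hd₀
  have hK : 0 < 2 - 1 / (d₀ : ℝ) := by
    have : 1 / (d₀ : ℝ) ≤ 1 := by rw [div_le_one (by linarith)]; exact hd
    linarith
  -- The radius is exactly the reciprocal of the witness constant.
  have hrad : ((d₀ : ℝ) / (2 * (d₀ : ℝ) - 1)) ^ (((k + 2 : ℕ) : ℝ) / 2 - 1) =
      (√(2 - 1 / (d₀ : ℝ)) ^ k)⁻¹ := by
    have e1 : (d₀ : ℝ) / (2 * (d₀ : ℝ) - 1) = (2 - 1 / (d₀ : ℝ))⁻¹ := by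
      have : (d₀ : ℝ) ≠ 0 := by linarith
      rw [← inv_div]
      congr 1
      field_simp
    have e2 : ((k + 2 : ℕ) : ℝ) / 2 - 1 = 1 / 2 * k := by push_cast; ring
    rw [e1, e2, Real.inv_rpow hK.le, Real.rpow_mul hK.le, ← Real.sqrt_eq_rpow, Real.rpow_natCast]
  rw [hrad] at hball
  have hpow : 0 < √(2 - 1 / (d₀ : ℝ)) ^ k := pow_pos (Real.sqrt_pos.2 hK) k
  have h1 : ‖ρ - 1‖ * ‖W‖ ≤ W.trace.re := by
    calc ‖ρ - 1‖ * ‖W‖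
        ≤ (√(2 - 1 / (d₀ : ℝ)) ^ k)⁻¹ * (√(2 - 1 / (d₀ : ℝ)) ^ k * W.trace.re) :=
          mul_le_mul hball (hW.frobenius_norm_le hd₀ k) (norm_nonneg _) (by positivity)
      _ = W.trace.re := by rw [inv_mul_cancel_left₀ hpow.ne']
  have h2 := Multipartite.abs_re_trace_mul_le (ρ - 1) W
  rw [Matrix.sub_mul, Matrix.one_mul, Matrix.trace_sub, Complex.sub_re] at h2
  have h3 := neg_abs_le ((ρ * W).trace.re - W.trace.re)
  linarith
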